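/- Let $K:[0,1]\times[0,1]\to\mathbb R$ be the kernel $K(x,y)=\frac12-\{(xy)^{-1}\}$ if $0<x,y\le 1$ and $K(x,y)=0$ if $xy=0$, where $\{t\}=t-\lfloor t\rfloor$, and let $\widetilde B_1(t)=\{t\}-\frac12$. There is an absolute constant $C$ such that the following holds. Let $\lambda\in\mathbb R$ and let $\phi:[0,1]\to\mathbb R$ be a square-integrable function with $\int_0^1\phi(x)^2\,dx=1$ and $\phi(x)=\lambda\int_0^1K(x,y)\phi(y)\,dy$ for all $x\in[0,1]$ (a normalized eigenfunction of $K$ with eigenvalue $\lambda$). Then: (i) for every $x\in(0,1]$ such that $\phi'(x)$ exists (at $x=1$ this is the left-hand derivative), $$\Bigl|x\phi'(x)+\lambda\,\phi(1)\,\widetilde B_1\!\left(\tfrac1x\right)\Bigr|\le C\,|\lambda|^5(\log|\lambda|)^2\Bigl(1+\log\tfrac1x\Bigr)x;$$ (ii) $\phi$ is differentiable almost everywhere in $[0,1]$, and the function $\phi'$ (defined almost everywhere) is Lebesgue integrable on $[0,1]$ if and only if $\phi(1)=0$. -/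

import Mathlib

open MeasureTheory Set

/-- The integral kernel `K` on `[0,1] × [0,1]`: it is `1/2 - {(xy)⁻¹}` for `0 < x, y ≤ 1` and `0`
where `xy = 0`. (Values outside the unit square are never used.) -/
noncomputable def kernelK (x y : ℝ) : ℝ :=
  if x * y = 0 then 0 else 1 / 2 - Int.fract (x * y)⁻¹

/-- The first periodic Bernoulli function `{t} - 1/2`. -/
noncomputable def periodicB1 (t : ℝ) : ℝ := Int.fract t - 1 / 2

/-- The (semi)norm of `L²([0,1])`. -/
noncomputable def unitL2Norm (f : ℝ → ℝ) : ℝ :=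
  Real.sqrt (∫ x in Icc (0 : ℝ) 1, f x ^ 2)

/-- `φ` (only its values on `[0,1]` matter) is an eigenfunction of `K` with eigenvalue `lam`:
it lies in `L²([0,1])`, has positive norm, and satisfies the integral equation at every point
of `[0,1]`. -/
structure IsEigenfunctionK (lam : ℝ) (φ : ℝ → ℝ) : Prop where
  memLp : MemLp φ 2 (volume.restrict (Icc (0 : ℝ) 1))
  norm_pos : 0 < unitL2Norm φ
  eq_integral : ∀ x ∈ Icc (0 : ℝ) 1, φ x = lam * ∫ y in Icc (0 : ℝ) 1, kernelK x y * φ y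

/-!
Write `B = periodicB1` and `opT f x = ∫₀¹ B(1/(xy)) f(y) dy`, so that an eigenfunction satisfies
`φ = -lam * opT φ` on `(0, 1]`; the right side is a bounded Borel function `ψ` on `ℝ`
(`IsEigenfunctionK.exists_boundedSolution`), with `|ψ| ≤ |lam| / 2` and `|lam| ≥ 2`.

The kernel depends on the product `x * y` only. Hence a dilation of `x` may be moved to the
variable of integration and from there to `ψ`, and the increments `d_r(x) = ψ(r x) - ψ(x)`,
`r < 1`, satisfy the eigenvalue equation up to `O(1 - r)` (`BoundedSolution.dilDiff_eq`). Everything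
is proved for these increments; no derivative is taken before the last step, `r → 1⁻`.

* *Uniform Lipschitz bound* `|d_r| ≤ 16 |lam|³ log² |lam| (1 - r)`
  (`BoundedSolution.abs_dilDiff_le_mul`). For `y ≥ η` the variation of the kernel is integrated
  directly (`integral_abs_recipB1_sub_le`); for `y ≤ η` the dilation is moved to `ψ`, which costs
  `η` times the quantity being bounded. For suitable `η` this quantity can be absorbed.
* *Decay of the iterated kernel* `G(z, s) = ∫₀¹ B(1/(zy)) B(1/(sy)) dy`, namely `|G(z, s)| ≤ z / s`
  (`abs_iterKernel_le_div`), by integrating by parts between the jumps of the second factor.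
* The dilation identity inserted into itself expresses `d_r` as `lam * ∫ᵣ¹ B(1/(xu)) ψ(u) du` plus
  `lam²` times integrals of `d_r` and `ψ` against `G` (`BoundedSolution.dilDiff_eq_iterate`). With
  the two bounds above, the remainder is `O(|lam|⁵ log² |lam| (1 + log (1/x)) x (1 - r))`.

Dividing by `1 - r` and letting `r → 1⁻` gives the estimate for `x φ'(x)`. By the Lipschitz bound
`φ` is differentiable almost everywhere, and by the estimate `φ'(x)` differs from
`-lam φ(1) B(1/x) / x` by `O(1 + log (1/x))`, which is integrable; but `B(1/x) / x` is not integrable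
near `0`, because `|B(t)| + |B(2t)| ≥ 1/4`.
-/

/-! ### The kernel under dilations -/

/-- The profile `z ↦ B̃₁(1/z)` of the kernel: `K(x, y) = -recipB1 (x * y)` when `x * y ≠ 0`. -/
noncomputable def recipB1 (z : ℝ) : ℝ := periodicB1 z⁻¹

theorem abs_periodicB1_le (t : ℝ) : |periodicB1 t| ≤ 1 / 2 := by
  have h0 := Int.fract_nonneg t
  have h1 := (Int.fract_lt_one t).le
  unfold periodicB1
  rw [abs_le]
  constructor <;> linarith

theorem abs_recipB1_le (z : ℝ) : |recipB1 z| ≤ 1 / 2 := abs_periodicB1_le _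

theorem measurable_periodicB1 : Measurable periodicB1 :=
  measurable_fract.sub_const _

theorem measurable_recipB1 : Measurable recipB1 :=
  measurable_periodicB1.comp measurable_inv

theorem Measurable.integrableOn_of_bdd {f : ℝ → ℝ} (hf : Measurable f) {C : ℝ}
    (hC : ∀ x, |f x| ≤ C) {s : Set ℝ} (hs : volume s ≠ ⊤) : IntegrableOn f s volume :=
  Measure.integrableOn_of_bounded hs hf.aestronglyMeasurable (M := C)
    (Filter.Eventually.of_forall hC)

theorem Measurable.intervalIntegrable_of_bdd {f : ℝ → ℝ} (hf : Measurable f) {C : ℝ}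
    (hC : ∀ x, |f x| ≤ C) (a b : ℝ) : IntervalIntegrable f volume a b :=
  ⟨hf.integrableOn_of_bdd hC measure_Ioc_lt_top.ne, hf.integrableOn_of_bdd hC measure_Ioc_lt_top.ne⟩

theorem abs_recipB1_mul_le {f : ℝ → ℝ} {C : ℝ} (hC : ∀ x, |f x| ≤ C) (g : ℝ → ℝ) (y : ℝ) :
    |recipB1 (g y) * f y| ≤ 1 / 2 * C := by
  rw [abs_mul]
  exact mul_le_mul (abs_recipB1_le _) (hC y) (abs_nonneg _) (by norm_num)

theorem intervalIntegrable_recipB1_mul {f : ℝ → ℝ} (hf : Measurable f) {C : ℝ}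
    (hC : ∀ x, |f x| ≤ C) (x a b : ℝ) :
    IntervalIntegrable (fun y => recipB1 (x * y) * f y) volume a b :=
  ((measurable_recipB1.comp (measurable_const_mul x)).mul hf).intervalIntegrable_of_bdd
    (abs_recipB1_mul_le hC fun y => x * y) a b

theorem abs_intervalIntegral_le_of_abs_le {f : ℝ → ℝ} {a b C : ℝ} (hab : a ≤ b)
    (h : ∀ y ∈ Ioc a b, |f y| ≤ C) : |∫ y in a..b, f y| ≤ C * (b - a) := by
  have := intervalIntegral.norm_integral_le_of_norm_le_const (a := a) (b := b) (f := f) (C := C)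
    (by rwa [uIoc_of_le hab])
  rwa [abs_of_nonneg (sub_nonneg.2 hab)] at this

/-- The integral operator `f ↦ ∫₀¹ B̃₁(1/(xy)) f(y) dy`, which is `-K`. -/
noncomputable def opT (f : ℝ → ℝ) (x : ℝ) : ℝ := ∫ y in (0 : ℝ)..1, recipB1 (x * y) * f y

theorem measurable_integral_recipB1_mul {f : ℝ → ℝ} (hf : Measurable f) (a b : ℝ) :
    Measurable fun x => ∫ y in a..b, recipB1 (x * y) * f y := by
  have h : StronglyMeasurable (Function.uncurry fun x y : ℝ => recipB1 (x * y) * f y) :=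
    ((measurable_recipB1.comp (measurable_fst.mul measurable_snd)).mul
      (hf.comp measurable_snd)).stronglyMeasurable
  unfold intervalIntegral
  exact (h.integral_prod_right.sub h.integral_prod_right).measurable

theorem abs_integral_recipB1_mul_le {f : ℝ → ℝ} {C : ℝ} (hC : ∀ x, |f x| ≤ C) {a b : ℝ}
    (hab : a ≤ b) (x : ℝ) : |∫ y in a..b, recipB1 (x * y) * f y| ≤ 1 / 2 * C * (b - a) :=
  abs_intervalIntegral_le_of_abs_le hab fun y _ => abs_recipB1_mul_le hC (fun y => x * y) y

theorem measurable_opT {f : ℝ → ℝ} (hf : Measurable f) : Measurable (opT f) :=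
  measurable_integral_recipB1_mul hf 0 1

theorem abs_opT_le {f : ℝ → ℝ} {C : ℝ} (hC : ∀ x, |f x| ≤ C) (x : ℝ) :
    |opT f x| ≤ 1 / 2 * C := by
  simpa [opT] using abs_integral_recipB1_mul_le hC zero_le_one x

/-- A bounded Borel solution on all of `ℝ` of the eigenvalue equation `ψ = -lam * opT ψ`. -/
structure BoundedSolution (lam A : ℝ) (ψ : ℝ → ℝ) : Prop where
  measurable : Measurable ψ
  bound : ∀ x, |ψ x| ≤ A
  eq : ∀ x, ψ x = -lam * opT ψ x

/-- The increment of `ψ` under the dilation `x ↦ r * x`. -/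
noncomputable def dilDiff (ψ : ℝ → ℝ) (r x : ℝ) : ℝ := ψ (r * x) - ψ x

/-- The boundary term `∫ᵣ¹ B̃₁(1/(xu)) ψ(u) du` produced by a dilation of the variable of
integration. -/
noncomputable def endTerm (ψ : ℝ → ℝ) (r x : ℝ) : ℝ := ∫ u in r..1, recipB1 (x * u) * ψ u

namespace BoundedSolution

variable {lam A : ℝ} {ψ : ℝ → ℝ}

theorem measurable_dilDiff (h : BoundedSolution lam A ψ) (r : ℝ) : Measurable (dilDiff ψ r) :=
  (h.measurable.comp (measurable_const_mul r)).sub h.measurable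

theorem abs_dilDiff_le (h : BoundedSolution lam A ψ) (r x : ℝ) : |dilDiff ψ r x| ≤ 2 * A := by
  have h1 := h.bound (r * x)
  have h2 := h.bound x
  have := abs_sub (ψ (r * x)) (ψ x)
  unfold dilDiff
  linarith

theorem intervalIntegrable (h : BoundedSolution lam A ψ) (x a b : ℝ) :
    IntervalIntegrable (fun y => recipB1 (x * y) * ψ y) volume a b :=
  intervalIntegrable_recipB1_mul h.measurable h.bound x a b

theorem intervalIntegrable_dilDiff (h : BoundedSolution lam A ψ) (r x a b : ℝ) :
    IntervalIntegrable (fun y => recipB1 (x * y) * dilDiff ψ r y) volume a b :=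
  intervalIntegrable_recipB1_mul (h.measurable_dilDiff r) (h.abs_dilDiff_le r) x a b

/-- Substituting `u = r * y`, i.e. moving the dilation from the kernel to `ψ`. -/
theorem integral_recipB1_dilate (h : BoundedSolution lam A ψ) {r : ℝ} (hr : r ≠ 0) (x η : ℝ) :
    ∫ y in (0 : ℝ)..η, recipB1 (r * x * y) * ψ y =
      r⁻¹ * (∫ u in (0 : ℝ)..r * η, recipB1 (x * u) * ψ u) -
        ∫ y in (0 : ℝ)..η, recipB1 (r * x * y) * dilDiff ψ r y := by
  have h1 := intervalIntegral.integral_comp_mul_left (a := 0) (b := η)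
    (fun u => recipB1 (x * u) * ψ u) hr
  rw [mul_zero, smul_eq_mul] at h1
  rw [← h1, ← intervalIntegral.integral_sub _ (h.intervalIntegrable_dilDiff r (r * x) 0 η)]
  · refine intervalIntegral.integral_congr fun y _ => ?_
    simp only [dilDiff]
    rw [show x * (r * y) = r * x * y by ring]
    ring
  · have := intervalIntegrable_recipB1_mul (h.measurable.comp (measurable_const_mul r))
      (fun y => h.bound (r * y)) (r * x) 0 η
    convert this using 3 with y
    · rw [show x * (r * y) = r * x * y by ring]
    · rfl

/-- The dilation identity: since the kernel depends on `x * y` only, `dilDiff ψ r` solves the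
eigenvalue equation at `r * x` up to `O(1 - r)`. -/
theorem dilDiff_eq (h : BoundedSolution lam A ψ) {r : ℝ} (hr : r ≠ 0) (x : ℝ) :
    r * dilDiff ψ r x =
      (1 - r) * ψ x + lam * r * opT (dilDiff ψ r) (r * x) + lam * endTerm ψ r x := by
  have h1 := h.integral_recipB1_dilate hr x 1
  have h2 := h.eq (r * x)
  have h3 := h.eq x
  have h4 := intervalIntegral.integral_add_adjacent_intervals
    (h.intervalIntegrable x 0 r) (h.intervalIntegrable x r 1)
  unfold opT at *
  unfold dilDiff endTerm at *
  rw [mul_one] at h1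
  rw [h1] at h2
  have h5 : r * ψ (r * x) = -lam * (∫ u in (0 : ℝ)..r, recipB1 (x * u) * ψ u) +
      lam * r * ∫ y in (0 : ℝ)..1, recipB1 (r * x * y) * (ψ (r * y) - ψ y) := by
    rw [h2]
    field_simp
    ring
  rw [← h4] at h3
  linear_combination h5 - h3

/-- Localised form of the dilation estimate: away from `0` the variation of the kernel is used,
and near `0` the increment itself. -/
theorem abs_dilDiff_le_split (h : BoundedSolution lam A ψ) {r η : ℝ} (hr : 0 < r) (hr1 : r ≤ 1)
    (hη : 0 ≤ η) (hη1 : η ≤ 1) (x : ℝ) :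
    |dilDiff ψ r x| ≤ |lam| * (A * (∫ y in η..1, |recipB1 (r * x * y) - recipB1 (x * y)|) +
      (1 - r) * η * A + 1 / 2 * ∫ y in (0 : ℝ)..η, |dilDiff ψ r y|) := by
  have hrη : r * η ≤ η := mul_le_of_le_one_left hη hr1
  set I1 := ∫ y in η..1, (recipB1 (r * x * y) - recipB1 (x * y)) * ψ y with hI1
  set I2 := ∫ u in (0 : ℝ)..r * η, recipB1 (x * u) * ψ u with hI2
  set I3 := ∫ u in r * η..η, recipB1 (x * u) * ψ u with hI3
  set I4 := ∫ y in (0 : ℝ)..η, recipB1 (r * x * y) * dilDiff ψ r y with hI4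
  have key : dilDiff ψ r x = -lam * (I1 + ((r⁻¹ - 1) * I2 - I3 - I4)) := by
    have h1 := h.integral_recipB1_dilate hr.ne' x η
    have h2 := h.eq (r * x)
    have h3 := h.eq x
    have h4 := intervalIntegral.integral_add_adjacent_intervals
      (h.intervalIntegrable x 0 (r * η)) (h.intervalIntegrable x (r * η) η)
    have h5 := intervalIntegral.integral_add_adjacent_intervals
      (h.intervalIntegrable x 0 η) (h.intervalIntegrable x η 1)
    have h6 := intervalIntegral.integral_add_adjacent_intervals
      (h.intervalIntegrable (r * x) 0 η) (h.intervalIntegrable (r * x) η 1)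
    have h7 : I1 = (∫ y in η..1, recipB1 (r * x * y) * ψ y) -
        ∫ y in η..1, recipB1 (x * y) * ψ y := by
      rw [hI1, ← intervalIntegral.integral_sub (h.intervalIntegrable (r * x) η 1)
        (h.intervalIntegrable x η 1)]
      simp only [sub_mul]
    unfold opT at h2 h3
    rw [dilDiff, h2, h3, ← h5, ← h6, h1, ← h4, h7]
    ring
  have b1 : |I1| ≤ A * ∫ y in η..1, |recipB1 (r * x * y) - recipB1 (x * y)| := by
    have hm : Measurable fun y => recipB1 (r * x * y) - recipB1 (x * y) :=
      (measurable_recipB1.comp (measurable_const_mul _)).sub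
        (measurable_recipB1.comp (measurable_const_mul _))
    have hb : ∀ y, |recipB1 (r * x * y) - recipB1 (x * y)| ≤ 1 := fun y => by
      have h1 := abs_recipB1_le (r * x * y)
      have h2 := abs_recipB1_le (x * y)
      have := abs_sub (recipB1 (r * x * y)) (recipB1 (x * y))
      linarith
    have hint : IntervalIntegrable (fun y => |recipB1 (r * x * y) - recipB1 (x * y)|)
        volume η 1 := hm.abs.intervalIntegrable_of_bdd (C := 1) (by simpa using hb) η 1
    rw [← Real.norm_eq_abs, ← intervalIntegral.integral_const_mul]
    refine intervalIntegral.norm_integral_le_of_norm_le hη1 (Filter.Eventually.of_forall ?_)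
      (hint.const_mul A)
    intro y _
    rw [norm_mul, mul_comm]
    exact mul_le_mul_of_nonneg_right (h.bound y) (norm_nonneg _)
  have b2 : |I2| ≤ 1 / 2 * A * (r * η) := by
    simpa using abs_integral_recipB1_mul_le h.bound (mul_nonneg hr.le hη) x
  have b3 : |I3| ≤ 1 / 2 * A * (η - r * η) := abs_integral_recipB1_mul_le h.bound hrη x
  have b4 : |I4| ≤ 1 / 2 * ∫ y in (0 : ℝ)..η, |dilDiff ψ r y| := by
    have hint : IntervalIntegrable (fun y => |dilDiff ψ r y|) volume 0 η :=
      (h.measurable_dilDiff r).abs.intervalIntegrable_of_bdd (C := 2 * A)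
        (by simpa using h.abs_dilDiff_le r) 0 η
    rw [← Real.norm_eq_abs, ← intervalIntegral.integral_const_mul]
    refine intervalIntegral.norm_integral_le_of_norm_le hη (Filter.Eventually.of_forall ?_)
      (hint.const_mul (1 / 2))
    intro y _
    rw [norm_mul]
    exact mul_le_mul_of_nonneg_right (abs_recipB1_le _) (norm_nonneg _)
  have b2' : |(r⁻¹ - 1) * I2| ≤ 1 / 2 * (1 - r) * η * A := by
    have hr' : 0 ≤ r⁻¹ - 1 := sub_nonneg.2 ((one_le_inv₀ hr).2 hr1)
    rw [abs_mul, abs_of_nonneg hr']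
    calc (r⁻¹ - 1) * |I2| ≤ (r⁻¹ - 1) * (1 / 2 * A * (r * η)) :=
          mul_le_mul_of_nonneg_left b2 hr'
      _ = 1 / 2 * (1 - r) * η * A := by field_simp
  rw [key, abs_mul, abs_neg]
  refine mul_le_mul_of_nonneg_left ?_ (abs_nonneg _)
  have t1 := abs_add_le I1 ((r⁻¹ - 1) * I2 - I3 - I4)
  have t2 := abs_sub ((r⁻¹ - 1) * I2 - I3) I4
  have t3 := abs_sub ((r⁻¹ - 1) * I2) I3
  linarith

end BoundedSolution

/-! ### Variation of the kernel under a dilation -/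

theorem antitoneOn_floor_inv {x : ℝ} (hx : 0 < x) :
    AntitoneOn (fun u : ℝ => (⌊(x * u)⁻¹⌋ : ℝ)) (Ioi 0) := by
  intro u hu v hv huv
  have hu' : 0 < x * u := mul_pos hx hu
  exact Int.cast_le.2 (Int.floor_mono (inv_anti₀ hu' (mul_le_mul_of_nonneg_left huv hx.le)))

theorem intervalIntegrable_floor_inv {x a b : ℝ} (hx : 0 < x) (ha : 0 < a) (hb : 0 < b) :
    IntervalIntegrable (fun u : ℝ => (⌊(x * u)⁻¹⌋ : ℝ)) volume a b :=
  ((antitoneOn_floor_inv hx).mono fun _ hu => (lt_min ha hb).trans_le hu.1).intervalIntegrable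

theorem intervalIntegrable_inv_mul {x a b : ℝ} (hx : 0 < x) (ha : 0 < a) (hb : 0 < b) :
    IntervalIntegrable (fun u : ℝ => (x * u)⁻¹) volume a b := by
  refine intervalIntegral.intervalIntegrable_inv (fun u hu => ?_) (by fun_prop)
  exact (mul_pos hx ((lt_min ha hb).trans_le hu.1)).ne'

theorem integral_inv_mul {x a b : ℝ} (ha : 0 < a) (hb : 0 < b) :
    ∫ u in a..b, (x * u)⁻¹ = x⁻¹ * Real.log (b / a) := by
  simp_rw [mul_inv]
  rw [intervalIntegral.integral_const_mul, integral_inv_of_pos ha hb]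

theorem integral_floor_inv_nonneg {x a b : ℝ} (hx : 0 < x) (ha : 0 < a) (hab : a ≤ b) :
    0 ≤ ∫ u in a..b, (⌊(x * u)⁻¹⌋ : ℝ) := by
  refine intervalIntegral.integral_nonneg hab fun u hu => ?_
  exact_mod_cast Int.floor_nonneg.2 (inv_nonneg.2 (mul_nonneg hx.le (ha.le.trans hu.1)))

theorem integral_floor_inv_le {x a b : ℝ} (hx : 0 < x) (ha : 0 < a) (hab : a ≤ b) :
    ∫ u in a..b, (⌊(x * u)⁻¹⌋ : ℝ) ≤ x⁻¹ * Real.log (b / a) := by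
  rw [← integral_inv_mul ha (ha.trans_le hab)]
  exact intervalIntegral.integral_mono_on hab
    (intervalIntegrable_floor_inv hx ha (ha.trans_le hab))
    (intervalIntegrable_inv_mul hx ha (ha.trans_le hab)) fun u _ => Int.floor_le _

theorem abs_recipB1_sub_le {r z : ℝ} (hr : 0 < r) (hr1 : r ≤ 1) (hz : 0 < z) :
    |recipB1 (r * z) - recipB1 z| ≤
      ((r * z)⁻¹ - z⁻¹) + ((⌊(r * z)⁻¹⌋ : ℝ) - (⌊z⁻¹⌋ : ℝ)) := by
  have h1 : z⁻¹ ≤ (r * z)⁻¹ := inv_anti₀ (mul_pos hr hz) (mul_le_of_le_one_left hz.le hr1)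
  have h2 : (⌊z⁻¹⌋ : ℝ) ≤ ⌊(r * z)⁻¹⌋ := Int.cast_le.2 (Int.floor_mono h1)
  unfold recipB1 periodicB1 Int.fract
  rw [abs_le]
  constructor <;> linarith

/-- The `L¹` modulus of continuity of the kernel under dilation, away from `y = 0`. The integer
parts increase under the dilation, so their difference is nonnegative and its integral is
computed by substituting `u = r * y`. -/
theorem integral_abs_recipB1_sub_le {r x η : ℝ} (hr : 1 / 2 ≤ r) (hr1 : r ≤ 1) (hx : 0 < x)
    (hη : 0 < η) (hη1 : η ≤ 1) :
    ∫ y in η..1, |recipB1 (r * x * y) - recipB1 (x * y)| ≤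
      (1 - r) * x⁻¹ * (4 * Real.log η⁻¹ + 4) := by
  have hr0 : 0 < r := by linarith
  have hrx : 0 < r * x := mul_pos hr0 hx
  have hle : ∫ y in η..1, |recipB1 (r * x * y) - recipB1 (x * y)| ≤
      ∫ y in η..1, (((r * x * y)⁻¹ - (x * y)⁻¹) +
        ((⌊(r * x * y)⁻¹⌋ : ℝ) - (⌊(x * y)⁻¹⌋ : ℝ))) := by
    refine intervalIntegral.integral_mono_on hη1 ?_ ?_ fun y hy => ?_
    · have hm : Measurable fun y => |recipB1 (r * x * y) - recipB1 (x * y)| :=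
        ((measurable_recipB1.comp (measurable_const_mul _)).sub
          (measurable_recipB1.comp (measurable_const_mul _))).abs
      refine hm.intervalIntegrable_of_bdd (C := 1) (fun y => ?_) η 1
      have h1 := abs_recipB1_le (r * x * y)
      have h2 := abs_recipB1_le (x * y)
      have := abs_sub (recipB1 (r * x * y)) (recipB1 (x * y))
      rw [abs_abs]
      linarith
    · exact ((intervalIntegrable_inv_mul hrx hη one_pos).sub
        (intervalIntegrable_inv_mul hx hη one_pos)).add
        ((intervalIntegrable_floor_inv hrx hη one_pos).sub
        (intervalIntegrable_floor_inv hx hη one_pos))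
    · rw [mul_assoc]
      exact abs_recipB1_sub_le hr0 hr1 (mul_pos hx (hη.trans_le hy.1))
  refine hle.trans ?_
  rw [intervalIntegral.integral_add
      ((intervalIntegrable_inv_mul hrx hη one_pos).sub (intervalIntegrable_inv_mul hx hη one_pos))
      ((intervalIntegrable_floor_inv hrx hη one_pos).sub
        (intervalIntegrable_floor_inv hx hη one_pos)),
    intervalIntegral.integral_sub (intervalIntegrable_inv_mul hrx hη one_pos)
      (intervalIntegrable_inv_mul hx hη one_pos),
    intervalIntegral.integral_sub (intervalIntegrable_floor_inv hrx hη one_pos)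
      (intervalIntegrable_floor_inv hx hη one_pos),
    integral_inv_mul hη one_pos, integral_inv_mul hη one_pos, one_div]
  have hsub : ∫ y in η..1, (⌊(r * x * y)⁻¹⌋ : ℝ) =
      r⁻¹ * ∫ u in r * η..r, (⌊(x * u)⁻¹⌋ : ℝ) := by
    have := intervalIntegral.integral_comp_mul_left (a := η) (b := 1)
      (fun u : ℝ => (⌊(x * u)⁻¹⌋ : ℝ)) hr0.ne'
    rw [mul_one, smul_eq_mul] at this
    rw [← this]
    refine intervalIntegral.integral_congr fun y _ => ?_
    rw [show x * (r * y) = r * x * y by ring]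
  have hrη : 0 < r * η := mul_pos hr0 hη
  have hsplit := intervalIntegral.integral_add_adjacent_intervals
    (intervalIntegrable_floor_inv hx hrη hη) (intervalIntegrable_floor_inv hx hη hr0)
  have hsplit' := intervalIntegral.integral_add_adjacent_intervals
    (intervalIntegrable_floor_inv hx hη hr0) (intervalIntegrable_floor_inv hx hr0 one_pos)
  have h1 := integral_floor_inv_nonneg hx hr0 hr1
  have h2 := integral_floor_inv_le hx hη hη1
  have h3 := integral_floor_inv_le hx hrη (mul_le_of_le_one_left hη.le hr1)
  rw [one_div] at h2
  rw [show η / (r * η) = r⁻¹ by field_simp] at h3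
  rw [hsub]
  have hri : 1 ≤ r⁻¹ := (one_le_inv₀ hr0).2 hr1
  have hri2 : r⁻¹ ≤ 2 := by
    rw [inv_le_comm₀ hr0 two_pos]
    linarith
  have hri3 : r⁻¹ - 1 ≤ 2 * (1 - r) := by
    have : r⁻¹ - 1 = r⁻¹ * (1 - r) := by field_simp
    rw [this]
    exact mul_le_mul_of_nonneg_right hri2 (by linarith)
  have hlogr : Real.log r⁻¹ ≤ r⁻¹ - 1 := Real.log_le_sub_one_of_pos (inv_pos.2 hr0)
  have hlogr0 : 0 ≤ Real.log r⁻¹ := Real.log_nonneg hri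
  have hlogη : 0 ≤ Real.log η⁻¹ := Real.log_nonneg ((one_le_inv₀ hη).2 hη1)
  have hxi : 0 < x⁻¹ := inv_pos.2 hx
  set J1 := ∫ u in r * η..η, (⌊(x * u)⁻¹⌋ : ℝ)
  set J2 := ∫ u in η..r, (⌊(x * u)⁻¹⌋ : ℝ)
  set J3 := ∫ u in r * η..r, (⌊(x * u)⁻¹⌋ : ℝ)
  set J4 := ∫ u in r..1, (⌊(x * u)⁻¹⌋ : ℝ)
  set J5 := ∫ u in η..1, (⌊(x * u)⁻¹⌋ : ℝ)
  -- The substitution leaves only the overlap `[r η, η]` and the excess factor `r⁻¹ - 1`.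
  have e1 : r⁻¹ * J3 - J5 ≤ (r⁻¹ - 1) * J5 + r⁻¹ * J1 := by
    have : 0 ≤ r⁻¹ * J4 := mul_nonneg (by linarith) h1
    have : r⁻¹ * J3 = r⁻¹ * J1 + r⁻¹ * J5 - r⁻¹ * J4 := by rw [← hsplit, ← hsplit']; ring
    linarith
  have e2 : (r⁻¹ - 1) * J5 ≤ 2 * (1 - r) * (x⁻¹ * Real.log η⁻¹) :=
    (mul_le_mul_of_nonneg_left h2 (by linarith)).trans
      (mul_le_mul_of_nonneg_right hri3 (mul_nonneg hxi.le hlogη))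
  have e3 : r⁻¹ * J1 ≤ 2 * (x⁻¹ * (2 * (1 - r))) :=
    (mul_le_mul_of_nonneg_left h3 (by linarith)).trans
      (mul_le_mul hri2 (mul_le_mul_of_nonneg_left (hlogr.trans hri3) hxi.le)
        (mul_nonneg hxi.le hlogr0) two_pos.le)
  have e4 : (r * x)⁻¹ * Real.log η⁻¹ - x⁻¹ * Real.log η⁻¹ ≤
      2 * (1 - r) * (x⁻¹ * Real.log η⁻¹) := by
    rw [mul_inv, show r⁻¹ * x⁻¹ * Real.log η⁻¹ - x⁻¹ * Real.log η⁻¹ =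
      (r⁻¹ - 1) * (x⁻¹ * Real.log η⁻¹) by ring]
    exact mul_le_mul_of_nonneg_right hri3 (mul_nonneg hxi.le hlogη)
  linarith

/-! ### Uniform Lipschitz bound for dilations -/

namespace BoundedSolution

variable {lam : ℝ} {ψ : ℝ → ℝ}

/-- A solution is Lipschitz with respect to dilations, uniformly down to `0`. With
`D = sup |dilDiff ψ r|` over `(0, 1]`, the localised dilation estimate cut at `η = |lam|⁻²` gives
`|dilDiff ψ r x| ≤ O(1 - r) / x + D / (2 |lam|)`; using this on `[(2 |lam|)⁻¹, 1]` in the estimate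
with `η = 1` gives `D ≤ D / 2 + O(1 - r)`, in which `D` can be absorbed because it is finite. -/
theorem abs_dilDiff_le_mul (h : BoundedSolution lam (|lam| / 2) ψ) (hlam : 2 ≤ |lam|) {r : ℝ}
    (hr : 1 / 2 ≤ r) (hr1 : r ≤ 1) {x : ℝ} (hx : x ∈ Ioc (0 : ℝ) 1) :
    |dilDiff ψ r x| ≤ 16 * |lam| ^ 3 * Real.log |lam| ^ 2 * (1 - r) := by
  set l := |lam| with hl
  set L := Real.log l with hL
  set d := dilDiff ψ r with hd
  have hr0 : 0 < r := by linarith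
  have hl0 : 0 < l := by linarith
  have hδ : 0 ≤ 1 - r := by linarith
  have hL2 : Real.log 2 ≤ L := Real.log_le_log two_pos hlam
  have hlog2 := Real.log_two_gt_d9
  have hbdd : BddAbove ((fun y => |d y|) '' Ioc (0 : ℝ) 1) :=
    ⟨2 * (l / 2), by rintro _ ⟨y, _, rfl⟩; exact h.abs_dilDiff_le r y⟩
  set D := sSup ((fun y => |d y|) '' Ioc (0 : ℝ) 1) with hD
  have hleD : ∀ y ∈ Ioc (0 : ℝ) 1, |d y| ≤ D := fun y hy => le_csSup hbdd ⟨y, hy, rfl⟩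
  have hD0 : 0 ≤ D := (abs_nonneg _).trans (hleD x hx)
  have hint : ∀ a b, IntervalIntegrable (fun y => |d y|) volume a b := fun a b =>
    (h.measurable_dilDiff r).abs.intervalIntegrable_of_bdd (C := 2 * (l / 2))
      (by simpa using h.abs_dilDiff_le r) a b
  have hsmall : ∀ η, 0 ≤ η → η ≤ 1 → ∫ y in (0 : ℝ)..η, |d y| ≤ D * η := fun η h0 h1 => by
    have := abs_intervalIntegral_le_of_abs_le (f := fun y => |d y|) (C := D) h0 fun y hy => by
      rw [abs_abs]
      exact hleD y ⟨hy.1, hy.2.trans h1⟩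
    rw [sub_zero] at this
    exact (le_abs_self _).trans this
  have stepA : ∀ y ∈ Ioc (0 : ℝ) 1,
      |d y| ≤ (1 - r) * (l ^ 2 * (4 * L + 2) * y⁻¹ + 1 / 2) + D / (2 * l) := by
    intro y hy
    have hη0 : 0 < (l ^ 2)⁻¹ := by positivity
    have hη1 : (l ^ 2)⁻¹ ≤ 1 := inv_le_one_of_one_le₀ (by nlinarith)
    have h1 := h.abs_dilDiff_le_split hr0 hr1 hη0.le hη1 y
    have h2 := integral_abs_recipB1_sub_le hr hr1 hy.1 hη0 hη1
    have h3 := hsmall _ hη0.le hη1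
    rw [inv_inv, Real.log_pow, Nat.cast_two] at h2
    calc |d y| ≤ _ := h1
      _ ≤ l * (l / 2 * ((1 - r) * y⁻¹ * (4 * (2 * L) + 4)) + (1 - r) * (l ^ 2)⁻¹ * (l / 2) +
            1 / 2 * (D * (l ^ 2)⁻¹)) := by gcongr
      _ = _ := by
        field_simp
        ring
  have stepB : ∫ y in (0 : ℝ)..1, |d y| ≤
      D / l + (1 - r) * (l ^ 2 * (4 * L + 2) * (2 * L) + 1 / 2) := by
    -- On `[0, (2 l)⁻¹]` use `|d| ≤ D`, on the rest `stepA`; both contribute `D / (2 l)`.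
    have hκ0 : 0 < (2 * l)⁻¹ := by positivity
    have hκ1 : (2 * l)⁻¹ ≤ 1 := inv_le_one_of_one_le₀ (by linarith)
    have h1 := hsmall _ hκ0.le hκ1
    have hlog : Real.log (2 * l) ≤ 2 * L := by
      rw [Real.log_mul two_ne_zero hl0.ne']
      linarith
    have hii : IntervalIntegrable (fun y : ℝ => y⁻¹) volume (2 * l)⁻¹ 1 := by
      simpa using intervalIntegrable_inv_mul one_pos hκ0 one_pos
    have h2 : ∫ y in (2 * l)⁻¹..1, |d y| ≤ ∫ y in (2 * l)⁻¹..1,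
        ((1 - r) * (l ^ 2 * (4 * L + 2)) * y⁻¹ + ((1 - r) / 2 + D / (2 * l))) := by
      refine intervalIntegral.integral_mono_on hκ1 (hint _ _)
        ((hii.const_mul _).add intervalIntegrable_const) fun y hy => ?_
      have := stepA y ⟨hκ0.trans_le hy.1, hy.2⟩
      linarith
    rw [intervalIntegral.integral_add (hii.const_mul _) intervalIntegrable_const,
      intervalIntegral.integral_const_mul, integral_inv_of_pos hκ0 one_pos,
      intervalIntegral.integral_const, smul_eq_mul, one_div, inv_inv] at h2
    have h3 : (1 - (2 * l)⁻¹) * ((1 - r) / 2 + D / (2 * l)) ≤ (1 - r) / 2 + D / (2 * l) :=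
      mul_le_of_le_one_left (by positivity) (by linarith)
    have h4 : (1 - r) * (l ^ 2 * (4 * L + 2)) * Real.log (2 * l) ≤
        (1 - r) * (l ^ 2 * (4 * L + 2)) * (2 * L) :=
      mul_le_mul_of_nonneg_left hlog
        (mul_nonneg hδ (mul_nonneg (by positivity) (by linarith)))
    rw [← intervalIntegral.integral_add_adjacent_intervals (hint 0 (2 * l)⁻¹) (hint _ 1)]
    have h5 : D * (2 * l)⁻¹ + D / (2 * l) = D / l := by field_simp; ring
    linarith
  have stepC : ∀ y ∈ Ioc (0 : ℝ) 1, |d y| ≤ D / 2 + (1 - r) * (8 * l ^ 3 * L ^ 2) := by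
    intro y hy
    have h1 := h.abs_dilDiff_le_split hr0 hr1 zero_le_one le_rfl y
    rw [intervalIntegral.integral_same, mul_zero, zero_add, mul_one] at h1
    calc |d y| ≤ _ := h1
      _ ≤ l * ((1 - r) * (l / 2) +
            1 / 2 * (D / l + (1 - r) * (l ^ 2 * (4 * L + 2) * (2 * L) + 1 / 2))) := by gcongr
      _ = D / 2 + (1 - r) * (l ^ 2 / 2 + l ^ 3 * (4 * L ^ 2 + 2 * L) + l / 4) := by
        field_simp
        ring
      _ ≤ _ := by
        have e1 : 1 ≤ 3 / 2 * L := by linarith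
        have e2 : 1 ≤ 9 / 4 * L ^ 2 := by nlinarith
        have e3 : l ^ 2 ≤ l ^ 3 / 2 := by nlinarith [sq_nonneg l]
        have e4 : l ≤ l ^ 2 / 2 := by nlinarith
        have e5 : l ^ 2 / 2 + l / 4 ≤ l ^ 3 * (5 / 16) := by linarith
        have e6 : l ^ 3 * (5 / 16) ≤ l ^ 3 * (5 / 16 * (9 / 4 * L ^ 2)) :=
          mul_le_mul_of_nonneg_left (by linarith) (by positivity)
        have e7 : l ^ 3 * (2 * L) ≤ l ^ 3 * (2 * (3 / 2 * L ^ 2)) :=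
          mul_le_mul_of_nonneg_left (by nlinarith) (by positivity)
        have e8 : 0 ≤ l ^ 3 * L ^ 2 := by positivity
        gcongr
        linarith
  have hDle : D ≤ D / 2 + (1 - r) * (8 * l ^ 3 * L ^ 2) :=
    csSup_le ⟨_, x, hx, rfl⟩ (by rintro _ ⟨y, hy, rfl⟩; exact stepC y hy)
  have := hleD x hx
  linarith

end BoundedSolution

/-! ### Decay of the iterated kernel -/

/-- The periodic antiderivative `({t}² - {t}) / 2` of `periodicB1`. -/
noncomputable def periodicB2 (t : ℝ) : ℝ := (Int.fract t ^ 2 - Int.fract t) / 2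

theorem abs_periodicB2_le (t : ℝ) : |periodicB2 t| ≤ 1 / 8 := by
  have h0 := Int.fract_nonneg t
  have h1 := (Int.fract_lt_one t).le
  unfold periodicB2
  rw [abs_le]
  constructor <;> nlinarith [sq_nonneg (Int.fract t - 1 / 2)]

theorem continuous_periodicB2 : Continuous periodicB2 := by
  have : ContinuousOn (fun t : ℝ => (t ^ 2 - t) / 2) (Icc 0 1) := by fun_prop
  exact this.comp_fract'' (by norm_num)

theorem hasDerivAt_periodicB2 {t : ℝ} (ht : ∀ n : ℤ, t ≠ n) :
    HasDerivAt periodicB2 (periodicB1 t) t := by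
  have hlt : (⌊t⌋ : ℝ) < t := lt_of_le_of_ne (Int.floor_le t) (ht _).symm
  have hev : periodicB2 =ᶠ[nhds t] fun u => ((u - ⌊t⌋) ^ 2 - (u - ⌊t⌋)) / 2 := by
    filter_upwards [Ioo_mem_nhds hlt (Int.lt_floor_add_one t)] with u hu
    have : ⌊u⌋ = ⌊t⌋ := Int.floor_eq_iff.2 ⟨hu.1.le, hu.2⟩
    simp only [periodicB2, Int.fract, this]
  refine HasDerivAt.congr_of_eventuallyEq ?_ hev
  have h1 : HasDerivAt (fun u : ℝ => u - ⌊t⌋) 1 t := (hasDerivAt_id t).sub_const _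
  refine (((h1.pow 2).sub h1).div_const 2).congr_deriv ?_
  simp only [periodicB1, Int.fract]
  push_cast
  ring

/-- On an interval without jumps of `y ↦ recipB1 (s * y)`, an integration by parts against the
antiderivative `-z y² periodicB2 (1 / (z y))` (up to a correction of the same size) of the other
factor gains a factor `z`. -/
theorem abs_integral_recipB1_mul_recipB1_piece {z s α γ : ℝ} {k : ℤ} (hz : 0 < z) (hs : 0 < s)
    (hα : 0 < α) (hαγ : α ≤ γ) (hγ : γ ≤ 1) (hk : (k : ℝ) ≤ (s * γ)⁻¹)
    (hk' : (s * α)⁻¹ ≤ k + 1) :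
    |∫ y in α..γ, recipB1 (z * y) * recipB1 (s * y)| ≤
      z * ((γ - α) / 8 + γ ^ 2 / 8 + (γ - α) / (8 * s)) := by
  set c : ℝ → ℝ := fun y => (s * y)⁻¹ - k - 1 / 2 with hc
  have hpos : ∀ y ∈ Icc α γ, 0 < y := fun y hy => hα.trans_le hy.1
  have hcb : ∀ y ∈ Icc α γ, |c y| ≤ 1 / 2 := by
    intro y hy
    have h1 : (s * γ)⁻¹ ≤ (s * y)⁻¹ :=
      inv_anti₀ (mul_pos hs (hpos y hy)) (mul_le_mul_of_nonneg_left hy.2 hs.le)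
    have h2 : (s * y)⁻¹ ≤ (s * α)⁻¹ :=
      inv_anti₀ (mul_pos hs hα) (mul_le_mul_of_nonneg_left hy.1 hs.le)
    rw [abs_le]
    constructor <;> simp only [hc] <;> linarith
  have hcβ : ∀ y ∈ Ioc α γ, recipB1 (s * y) = c y := by
    intro y hy
    have h1 : (s * γ)⁻¹ ≤ (s * y)⁻¹ :=
      inv_anti₀ (mul_pos hs (hα.trans hy.1)) (mul_le_mul_of_nonneg_left hy.2 hs.le)
    have h2 : (s * y)⁻¹ < (s * α)⁻¹ :=
      inv_strictAnti₀ (mul_pos hs hα) (mul_lt_mul_of_pos_left hy.1 hs)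
    have : ⌊(s * y)⁻¹⌋ = k := Int.floor_eq_iff.2 ⟨by linarith, by linarith⟩
    simp only [recipB1, periodicB1, Int.fract, this, hc]
  have hcont_inv : ∀ a : ℝ, 0 < a → ContinuousOn (fun y : ℝ => (a * y)⁻¹) (Icc α γ) :=
    fun a ha => ContinuousOn.inv₀ (by fun_prop) fun y hy => (mul_pos ha (hpos y hy)).ne'
  have hc_cont : ContinuousOn c (Icc α γ) :=
    ((hcont_inv s hs).sub continuousOn_const).sub continuousOn_const
  have hP_cont : ContinuousOn (fun y : ℝ => periodicB2 (z * y)⁻¹) (Icc α γ) :=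
    continuous_periodicB2.comp_continuousOn (hcont_inv z hz)
  set E : ℝ → ℝ := fun y =>
    2 * z * y * periodicB2 (z * y)⁻¹ * c y - z * periodicB2 (z * y)⁻¹ / s with hE
  set F : ℝ → ℝ := fun y => -(z * y ^ 2 * periodicB2 (z * y)⁻¹ * c y) with hF
  have hE_cont : ContinuousOn E (Icc α γ) := by
    refine ContinuousOn.sub (ContinuousOn.mul (ContinuousOn.mul ?_ hP_cont) hc_cont)
      (ContinuousOn.div_const (continuousOn_const.mul hP_cont) _)
    fun_prop
  have hF_cont : ContinuousOn F (Icc α γ) := by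
    refine ContinuousOn.neg (ContinuousOn.mul (ContinuousOn.mul ?_ hP_cont) hc_cont)
    fun_prop
  have hE_int : IntervalIntegrable E volume α γ :=
    hE_cont.intervalIntegrable_of_Icc hαγ
  have hm : IntervalIntegrable (fun y => recipB1 (z * y)) volume α γ :=
    (measurable_recipB1.comp (measurable_const_mul z)).intervalIntegrable_of_bdd
      (fun y => abs_recipB1_le _) α γ
  have hβc : IntervalIntegrable (fun y => recipB1 (z * y) * c y) volume α γ :=
    hm.mul_continuousOn (by rwa [uIcc_of_le hαγ])
  have hcongr : ∫ y in α..γ, recipB1 (z * y) * recipB1 (s * y) =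
      ∫ y in α..γ, recipB1 (z * y) * c y := by
    refine intervalIntegral.integral_congr_ae (Filter.Eventually.of_forall fun y hy => ?_)
    rw [uIoc_of_le hαγ] at hy
    rw [hcβ y hy]
  have hFTC : ∫ y in α..γ, (recipB1 (z * y) * c y - E y) = F γ - F α := by
    refine integral_eq_of_hasDerivAt_off_countable_of_le F _ hαγ
      (countable_range fun n : ℤ => (z * (n : ℝ))⁻¹) hF_cont ?_ (hβc.sub hE_int)
    rintro y ⟨hy, hyn⟩
    have hy0 : 0 < y := hα.trans hy.1
    have hni : ∀ n : ℤ, (z * y)⁻¹ ≠ n := by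
      intro n hn
      refine hyn ⟨n, ?_⟩
      simp only
      rw [← hn]
      field_simp
    have hinv : ∀ a : ℝ, 0 < a → HasDerivAt (fun u : ℝ => (a * u)⁻¹) (-a / (a * y) ^ 2) y := by
      intro a ha
      have := ((hasDerivAt_id y).const_mul a).inv (mul_pos ha hy0).ne'
      exact this.congr_deriv (by simp)
    have hP := (hasDerivAt_periodicB2 hni).comp y (hinv z hz)
    have hcd : HasDerivAt c (-s / (s * y) ^ 2) y := ((hinv s hs).sub_const _).sub_const _
    have hsq : HasDerivAt (fun u : ℝ => z * u ^ 2) (z * (2 * y)) y := by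
      simpa using ((hasDerivAt_id y).pow 2).const_mul z
    refine ((hsq.mul hP).mul hcd).neg.congr_deriv ?_
    simp only [hE, Function.comp, recipB1, Pi.mul_apply]
    field_simp
    ring
  have hEb : |∫ y in α..γ, E y| ≤ z * (1 / 8 + 1 / (8 * s)) * (γ - α) := by
    refine abs_intervalIntegral_le_of_abs_le hαγ fun y hy => ?_
    have hy' : y ∈ Icc α γ := ⟨hy.1.le, hy.2⟩
    have hP := abs_periodicB2_le (z * y)⁻¹
    have hcy := hcb y hy'
    have hy0 := hpos y hy'
    calc |E y| ≤ |2 * z * y * periodicB2 (z * y)⁻¹ * c y| + |z * periodicB2 (z * y)⁻¹ / s| :=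
          abs_sub _ _
      _ = 2 * z * y * |periodicB2 (z * y)⁻¹| * |c y| + z * |periodicB2 (z * y)⁻¹| / s := by
          rw [abs_mul, abs_mul, abs_of_pos (by positivity : 0 < 2 * z * y), abs_div, abs_mul,
            abs_of_pos hz, abs_of_pos hs]
      _ ≤ 2 * z * 1 * (1 / 8) * (1 / 2) + z * (1 / 8) / s := by
          gcongr
          exact hy.2.trans hγ
      _ = z * (1 / 8 + 1 / (8 * s)) := by
          field_simp
  have hFb : ∀ y ∈ Icc α γ, |F y| ≤ z * γ ^ 2 / 16 := by
    intro y hy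
    have hP := abs_periodicB2_le (z * y)⁻¹
    have hcy := hcb y hy
    have hy0 := hpos y hy
    calc |F y| = z * y ^ 2 * |periodicB2 (z * y)⁻¹| * |c y| := by
          simp only [hF]
          rw [abs_neg, abs_mul, abs_mul, abs_of_pos (by positivity : 0 < z * y ^ 2)]
      _ ≤ z * γ ^ 2 * (1 / 8) * (1 / 2) := by
          gcongr
          exact hy.2
      _ = z * γ ^ 2 / 16 := by ring
  have hmain : ∫ y in α..γ, recipB1 (z * y) * recipB1 (s * y) =
      F γ - F α + ∫ y in α..γ, E y := by
    rw [hcongr, ← hFTC, intervalIntegral.integral_sub hβc hE_int]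
    ring
  rw [hmain]
  have t1 := abs_add_le (F γ - F α) (∫ y in α..γ, E y)
  have t2 := abs_sub (F γ) (F α)
  have t3 := hFb γ (right_mem_Icc.2 hαγ)
  have t4 := hFb α (left_mem_Icc.2 hαγ)
  have t5 : z * (1 / 8 + 1 / (8 * s)) * (γ - α) =
      z * ((γ - α) / 8 + (γ - α) / (8 * s)) := by
    field_simp
  linarith

/-- The kernel `∫₀¹ B̃₁(1/(zy)) B̃₁(1/(sy)) dy` of `opT ∘ opT`. -/
noncomputable def iterKernel (z s : ℝ) : ℝ :=
  ∫ y in (0 : ℝ)..1, recipB1 (z * y) * recipB1 (s * y)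

theorem intervalIntegrable_recipB1_mul_recipB1 (z s a b : ℝ) :
    IntervalIntegrable (fun y => recipB1 (z * y) * recipB1 (s * y)) volume a b :=
  intervalIntegrable_recipB1_mul (measurable_recipB1.comp (measurable_const_mul s))
    (fun _ => abs_recipB1_le _) z a b

theorem abs_iterKernel_le (z s : ℝ) : |iterKernel z s| ≤ 1 / 4 := by
  have := abs_integral_recipB1_mul_le (f := fun y => recipB1 (s * y)) (C := 1 / 2)
    (fun _ => abs_recipB1_le _) zero_le_one z
  unfold iterKernel
  linarith

/-- Decay of the iterated kernel. On the jump-free interval `[1/(s(k+1)), 1/(sk)]` the boundary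
terms, of size `(1/(sk))²`, are at most `2/s` times the length, so that the bounds for these
intervals add up. -/
theorem abs_iterKernel_le_div {z s : ℝ} (hz : 0 < z) (hs : 0 < s) (hs1 : s ≤ 1) :
    |iterKernel z s| ≤ z / s := by
  set f : ℝ → ℝ := fun y => recipB1 (z * y) * recipB1 (s * y) with hf
  have hint : ∀ a b, IntervalIntegrable f volume a b :=
    intervalIntegrable_recipB1_mul_recipB1 z s
  -- The jumps in `(0, 1)` of the second factor are the points `g m = 1 / (s (k + 1 + m))`.
  set k : ℕ := ⌊s⁻¹⌋₊ with hk
  have hks : (k : ℝ) ≤ s⁻¹ := Nat.floor_le (inv_pos.2 hs).le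
  have hks' : s⁻¹ < k + 1 := Nat.lt_floor_add_one _
  set g : ℕ → ℝ := fun m => (s * (k + 1 + m))⁻¹ with hg
  have hg0 : ∀ m, 0 < g m := fun m => by positivity
  have hsg : ∀ m, (s * g m)⁻¹ = k + 1 + m := fun m => by
    have : (k : ℝ) + 1 + m ≠ 0 := by positivity
    simp only [hg]
    field_simp
  have hg1 : g 0 ≤ 1 := by
    simp only [hg]
    refine inv_le_one_of_one_le₀ ?_
    have := mul_lt_mul_of_pos_left hks' hs
    rw [mul_inv_cancel₀ hs.ne'] at this
    push_cast
    linarith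
  have hgm : ∀ m, g (m + 1) ≤ g m := fun m => by
    simp only [hg]
    refine inv_anti₀ (by positivity) (mul_le_mul_of_nonneg_left ?_ hs.le)
    push_cast
    linarith
  have hg1' : ∀ m, g m ≤ 1 := fun m => (antitone_nat_of_succ_le hgm (Nat.zero_le m)).trans hg1
  have hgsq : ∀ m, g m ^ 2 ≤ 2 / s * (g m - g (m + 1)) := fun m => by
    have h1 : (0 : ℝ) ≤ k + m := by positivity
    have : g m - g (m + 1) = (s * (k + 1 + m) * (k + 2 + m))⁻¹ := by
      simp only [hg]
      push_cast
      field_simp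
      ring
    rw [this]
    simp only [hg]
    rw [inv_pow, div_mul_eq_mul_div, le_div_iff₀ hs, ← div_eq_mul_inv, inv_mul_eq_div,
      div_le_div_iff₀ (by positivity) (by positivity)]
    nlinarith [mul_nonneg (sq_nonneg s) h1, mul_nonneg (mul_nonneg (sq_nonneg s) h1) h1,
      sq_nonneg s]
  have hs1' : 1 ≤ 1 / s := (one_le_div hs).2 hs1
  have hfirst : |∫ y in g 0..1, f y| ≤ z * (3 / 8 / s) := by
    have := abs_integral_recipB1_mul_recipB1_piece (k := k) hz hs (hg0 0) hg1 le_rfl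
      (by simpa using hks) (by rw [hsg]; simp)
    refine this.trans (mul_le_mul_of_nonneg_left ?_ hz.le)
    have h1 : (1 - g 0) / (8 * s) ≤ 1 / (8 * s) := by
      gcongr
      linarith [hg0 0]
    have h2 : 1 / (8 * s) = 1 / 8 * (1 / s) := by field_simp
    have h3 : 3 / 8 / s = 3 / 8 * (1 / s) := by field_simp
    rw [h3]
    linarith [hg0 0]
  have hmid : ∀ m, |∫ y in g m..g 0, f y| ≤ z * ((g 0 - g m) / (2 * s)) := by
    intro m
    induction m with
    | zero => simp
    | succ m ih =>
      rw [← intervalIntegral.integral_add_adjacent_intervals (hint (g (m + 1)) (g m))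
        (hint (g m) (g 0))]
      have hp := abs_integral_recipB1_mul_recipB1_piece (k := k + 1 + m) hz hs (hg0 (m + 1))
        (hgm m) (hg1' m) (by rw [hsg]; push_cast; exact le_rfl)
        (by rw [hsg]; push_cast; linarith)
      have hle : z * ((g m - g (m + 1)) / 8 + g m ^ 2 / 8 + (g m - g (m + 1)) / (8 * s)) ≤
          z * ((g m - g (m + 1)) / (2 * s)) := by
        refine mul_le_mul_of_nonneg_left ?_ hz.le
        have h1 := hgsq m
        have h2 : g m - g (m + 1) ≤ (g m - g (m + 1)) * (1 / s) :=
          le_mul_of_one_le_right (by linarith [hgm m]) hs1'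
        have h3 : (g m - g (m + 1)) / (8 * s) = 1 / 8 * ((g m - g (m + 1)) * (1 / s)) := by
          field_simp
        have h4 : (g m - g (m + 1)) / (2 * s) = 1 / 2 * ((g m - g (m + 1)) * (1 / s)) := by
          field_simp
        have h5 : 2 / s * (g m - g (m + 1)) = 2 * ((g m - g (m + 1)) * (1 / s)) := by
          field_simp
        rw [h3, h4]
        linarith
      refine (abs_add_le _ _).trans ((add_le_add (hp.trans hle) ih).trans (le_of_eq ?_))
      ring
  have hlast : ∀ m, |∫ y in (0 : ℝ)..g m, f y| ≤ 1 / 4 * g m := fun m => by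
    have := abs_integral_recipB1_mul_le (f := fun y => recipB1 (s * y)) (C := 1 / 2)
      (fun _ => abs_recipB1_le _) (hg0 m).le z
    rw [sub_zero] at this
    linarith
  have hall : ∀ m, |iterKernel z s| ≤ z / s + 1 / 4 * g m := by
    intro m
    have e : iterKernel z s = (∫ y in (0 : ℝ)..g m, f y) + (∫ y in g m..g 0, f y) +
        ∫ y in g 0..1, f y := by
      rw [intervalIntegral.integral_add_adjacent_intervals (hint _ _) (hint _ _),
        intervalIntegral.integral_add_adjacent_intervals (hint _ _) (hint _ _)]
      rfl
    rw [e]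
    have h1 : z * ((g 0 - g m) / (2 * s)) ≤ z * (1 / 2 / s) := by
      refine mul_le_mul_of_nonneg_left ?_ hz.le
      rw [div_div]
      gcongr
      linarith [hg0 m]
    have h2 : z * (1 / 2 / s) + z * (3 / 8 / s) ≤ z / s := by
      have : z * (1 / 2 / s) + z * (3 / 8 / s) = 7 / 8 * (z / s) := by
        field_simp
        norm_num
      rw [this]
      linarith [div_pos hz hs]
    have t1 := abs_add_le ((∫ y in (0 : ℝ)..g m, f y) + (∫ y in g m..g 0, f y))
      (∫ y in g 0..1, f y)
    have t2 := abs_add_le (∫ y in (0 : ℝ)..g m, f y) (∫ y in g m..g 0, f y)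
    linarith [hmid m, hlast m]
  have hlim : Filter.Tendsto (fun m : ℕ => z / s + 1 / 4 * g m) Filter.atTop
      (nhds (z / s + 1 / 4 * 0)) := by
    refine (Filter.Tendsto.const_mul _ ?_).const_add _
    refine Filter.Tendsto.inv_tendsto_atTop ?_
    exact (Filter.tendsto_atTop_add_const_left _ _ tendsto_natCast_atTop_atTop).const_mul_atTop hs
  have := ge_of_tendsto' hlim hall
  simpa using this

/-! ### Increments modulo the boundary term -/

theorem opT_integral_recipB1 {f : ℝ → ℝ} (hf : Measurable f) {C : ℝ} (hC : ∀ x, |f x| ≤ C)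
    (z c a b : ℝ) :
    opT (fun y => ∫ s in a..b, recipB1 (c * y * s) * f s) z =
      ∫ s in a..b, iterKernel z (c * s) * f s := by
  have hm : Measurable (Function.uncurry fun y s : ℝ =>
      recipB1 (z * y) * (recipB1 (c * y * s) * f s)) :=
    (measurable_recipB1.comp (measurable_fst.const_mul z)).mul
      ((measurable_recipB1.comp ((measurable_fst.const_mul c).mul measurable_snd)).mul
        (hf.comp measurable_snd))
  have hint : IntegrableOn (Function.uncurry fun y s : ℝ =>
      recipB1 (z * y) * (recipB1 (c * y * s) * f s)) (uIoc 0 1 ×ˢ uIoc a b) := by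
    refine Measure.integrableOn_of_bounded (M := 1 / 2 * (1 / 2 * C)) ?_
      hm.aestronglyMeasurable (Filter.Eventually.of_forall fun p => ?_)
    · rw [Measure.volume_eq_prod, Measure.prod_prod]
      exact ENNReal.mul_ne_top measure_Ioc_lt_top.ne measure_Ioc_lt_top.ne
    · have h1 := abs_recipB1_mul_le hC (fun s => c * p.1 * s) p.2
      have h2 := abs_recipB1_le (z * p.1)
      rw [Function.uncurry, norm_mul]
      exact mul_le_mul h2 h1 (norm_nonneg _) (by norm_num)
  unfold opT iterKernel
  simp_rw [← intervalIntegral.integral_const_mul, ← intervalIntegral.integral_mul_const]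
  rw [intervalIntegral_intervalIntegral_swap hint]
  refine intervalIntegral.integral_congr fun s _ => intervalIntegral.integral_congr fun y _ => ?_
  rw [show c * s * y = c * y * s by ring]
  ring

namespace BoundedSolution

variable {lam A : ℝ} {ψ : ℝ → ℝ}

theorem measurable_endTerm (h : BoundedSolution lam A ψ) (r : ℝ) : Measurable (endTerm ψ r) :=
  measurable_integral_recipB1_mul h.measurable r 1

theorem abs_endTerm_le (h : BoundedSolution lam A ψ) {r : ℝ} (hr : r ≤ 1) (x : ℝ) :
    |endTerm ψ r x| ≤ 1 / 2 * A * (1 - r) :=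
  abs_integral_recipB1_mul_le h.bound hr x

/-- The dilation identity inserted into itself. The two terms in `ψ` combine to `dilDiff ψ r`
because `ψ = -lam * opT ψ`, so that only applications of `opT ∘ opT` and the boundary term
remain. -/
theorem dilDiff_eq_iterate (h : BoundedSolution lam A ψ) {r : ℝ} (hr : 0 < r) (hr1 : r ≤ 1)
    (x : ℝ) :
    dilDiff ψ r x = lam ^ 2 * (r * opT (fun y => opT (dilDiff ψ r) (r * y)) (r * x) +
      opT (endTerm ψ r) (r * x)) + lam * endTerm ψ r x := by
  have hd := h.measurable_dilDiff r
  have hg : Measurable fun y => opT (dilDiff ψ r) (r * y) :=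
    (measurable_opT hd).comp (measurable_const_mul r)
  have hlin : r * opT (dilDiff ψ r) (r * x) = (1 - r) * opT ψ (r * x) +
      lam * r * opT (fun y => opT (dilDiff ψ r) (r * y)) (r * x) +
      lam * opT (endTerm ψ r) (r * x) := by
    have i1 := h.intervalIntegrable (r * x) 0 1
    have i2 := intervalIntegrable_recipB1_mul hg
      (fun y => abs_opT_le (h.abs_dilDiff_le r) (r * y)) (r * x) 0 1
    have i3 := intervalIntegrable_recipB1_mul (h.measurable_endTerm r)
      (h.abs_endTerm_le hr1) (r * x) 0 1
    rw [opT, opT.eq_1 ψ, opT.eq_1 (endTerm ψ r), opT.eq_1 (fun y => opT (dilDiff ψ r) (r * y)),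
      ← intervalIntegral.integral_const_mul, ← intervalIntegral.integral_const_mul,
      ← intervalIntegral.integral_const_mul, ← intervalIntegral.integral_const_mul,
      ← intervalIntegral.integral_add (i1.const_mul _) (i2.const_mul _),
      ← intervalIntegral.integral_add ((i1.const_mul _).add (i2.const_mul _)) (i3.const_mul _)]
    refine intervalIntegral.integral_congr fun y _ => ?_
    have := h.dilDiff_eq hr.ne' y
    linear_combination recipB1 (r * x * y) * this
  have h1 := h.dilDiff_eq hr.ne' x
  have h2 := h.eq (r * x)
  have h3 : ψ (r * x) = dilDiff ψ r x + ψ x := by simp [dilDiff]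
  rw [h3] at h2
  linear_combination h1 + lam * hlin + (1 - r) * h2

/-- Up to the boundary term, the increments of `ψ` inherit the decay of the iterated kernel. -/
theorem abs_dilDiff_sub_endTerm_le (h : BoundedSolution lam A ψ) {r x D : ℝ} (hr : 0 < r)
    (hr1 : r ≤ 1) (hD : ∀ y ∈ Ioc (0 : ℝ) 1, |dilDiff ψ r y| ≤ D) (hx : x ∈ Ioc (0 : ℝ) 1) :
    |dilDiff ψ r x - lam * endTerm ψ r x| ≤
      lam ^ 2 * (D * (1 + Real.log (1 / x)) * x + A * (1 - r) * x) := by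
  have hx0 : 0 < x := hx.1
  have hD0 : 0 ≤ D := (abs_nonneg _).trans (hD x hx)
  have hrx : 0 < r * x := mul_pos hr hx0
  have e1 : opT (fun y => opT (dilDiff ψ r) (r * y)) (r * x) =
      ∫ s in (0 : ℝ)..1, iterKernel (r * x) (r * s) * dilDiff ψ r s :=
    opT_integral_recipB1 (h.measurable_dilDiff r) (h.abs_dilDiff_le r) (r * x) r 0 1
  have e2 : opT (endTerm ψ r) (r * x) = ∫ u in r..1, iterKernel (r * x) u * ψ u := by
    have := opT_integral_recipB1 h.measurable h.bound (r * x) 1 r 1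
    simp only [one_mul] at this
    exact this
  have hGm : Measurable fun s => iterKernel (r * x) (r * s) := by
    have : (fun s => iterKernel (r * x) (r * s)) =
        fun s => opT (fun y => recipB1 (r * x * y)) (r * s) := by
      funext s
      simp only [iterKernel, opT, mul_comm (recipB1 (r * x * _))]
    rw [this]
    exact (measurable_opT (measurable_recipB1.comp (measurable_const_mul (r * x)))).comp
      (measurable_const_mul r)
  have hint : ∀ a b, IntervalIntegrable
      (fun s => iterKernel (r * x) (r * s) * dilDiff ψ r s) volume a b := fun a b => by
    refine (hGm.mul (h.measurable_dilDiff r)).intervalIntegrable_of_bdd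
      (C := 1 / 4 * (2 * A)) (fun s => ?_) a b
    rw [Pi.mul_apply, abs_mul]
    exact mul_le_mul (abs_iterKernel_le _ _) (h.abs_dilDiff_le r s) (abs_nonneg _) (by norm_num)
  have b1 : |∫ s in (0 : ℝ)..1, iterKernel (r * x) (r * s) * dilDiff ψ r s| ≤
      D * (1 + Real.log (1 / x)) * x := by
    -- For `s ≤ x` the trivial bound on the kernel is the better one; for `s ≥ x` use `x / s`.
    rw [← intervalIntegral.integral_add_adjacent_intervals (hint 0 x) (hint x 1)]
    have c1 : |∫ s in (0 : ℝ)..x, iterKernel (r * x) (r * s) * dilDiff ψ r s| ≤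
        1 / 4 * D * (x - 0) := by
      refine abs_intervalIntegral_le_of_abs_le hx0.le fun s hs => ?_
      rw [abs_mul]
      exact mul_le_mul (abs_iterKernel_le _ _) (hD s ⟨hs.1, hs.2.trans hx.2⟩) (abs_nonneg _)
        (by norm_num)
    have c2 : |∫ s in x..1, iterKernel (r * x) (r * s) * dilDiff ψ r s| ≤
        x * D * Real.log (1 / x) := by
      rw [← integral_inv_of_pos hx0 one_pos, ← intervalIntegral.integral_const_mul,
        ← Real.norm_eq_abs]
      refine intervalIntegral.norm_integral_le_of_norm_le hx.2
        (Filter.Eventually.of_forall fun s hs => ?_) (IntervalIntegrable.const_mul ?_ _)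
      · have hs0 : 0 < s := hx0.trans hs.1
        have hG := abs_iterKernel_le_div hrx (mul_pos hr hs0) (mul_le_one₀ hr1 hs0.le hs.2)
        rw [norm_mul]
        calc ‖iterKernel (r * x) (r * s)‖ * ‖dilDiff ψ r s‖ ≤ (r * x) / (r * s) * D :=
              mul_le_mul hG (hD s ⟨hs0, hs.2⟩) (norm_nonneg _)
                (div_nonneg hrx.le (mul_pos hr hs0).le)
          _ = x * D * s⁻¹ := by field_simp
      · simpa using intervalIntegrable_inv_mul one_pos hx0 one_pos
    refine (abs_add_le _ _).trans ((add_le_add c1 c2).trans ?_)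
    have := mul_nonneg hD0 hx0.le
    linarith
  have b2 : |∫ u in r..1, iterKernel (r * x) u * ψ u| ≤ A * (1 - r) * x := by
    have := abs_intervalIntegral_le_of_abs_le (f := fun u => iterKernel (r * x) u * ψ u)
      (C := x * A) hr1 fun u hu => by
        have hu0 : 0 < u := hr.trans hu.1
        have hG := abs_iterKernel_le_div hrx hu0 hu.2
        have hle : r * x / u ≤ x := by
          rw [div_le_iff₀ hu0, mul_comm]
          exact mul_le_mul_of_nonneg_left hu.1.le hx0.le
        rw [abs_mul]
        exact mul_le_mul (hG.trans hle) (h.bound u) (abs_nonneg _) hx0.le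
    linarith
  rw [h.dilDiff_eq_iterate hr hr1 x, e1, e2, add_sub_cancel_right, abs_mul,
    abs_of_nonneg (sq_nonneg lam)]
  refine mul_le_mul_of_nonneg_left ((abs_add_le _ _).trans (add_le_add ?_ b2)) (sq_nonneg lam)
  rw [abs_mul, abs_of_pos hr]
  exact (mul_le_of_le_one_left (abs_nonneg _) hr1).trans b1

theorem abs_dilDiff_sub_endTerm_le_mul (h : BoundedSolution lam (|lam| / 2) ψ)
    (hlam : 2 ≤ |lam|) {r x : ℝ} (hr : 1 / 2 ≤ r) (hr1 : r ≤ 1) (hx : x ∈ Ioc (0 : ℝ) 1) :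
    |dilDiff ψ r x - lam * endTerm ψ r x| ≤
      17 * (|lam| ^ 5 * Real.log |lam| ^ 2 * (1 + Real.log (1 / x)) * x) * (1 - r) := by
  have hmain := h.abs_dilDiff_sub_endTerm_le (by linarith) hr1
    (fun y hy => h.abs_dilDiff_le_mul hlam hr hr1 hy) hx
  have hlog : 0 ≤ Real.log (1 / x) := Real.log_nonneg ((one_le_div hx.1).2 hx.2)
  rw [← sq_abs lam] at hmain
  refine hmain.trans ?_
  set l := |lam|
  set L := Real.log l
  have hL2 : Real.log 2 ≤ L := Real.log_le_log two_pos hlam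
  have hL : 1 / 2 ≤ L := by linarith [Real.log_two_gt_d9]
  -- The term `|lam|³ / 2` from `ψ` is absorbed into `|lam|⁵ log² |lam|`, as `|lam| ≥ 2`.
  have e1 : 1 ≤ 4 * L ^ 2 := by nlinarith
  have e2 : 1 ≤ l ^ 2 / 4 := by nlinarith
  have e3 : 1 ≤ l ^ 2 * L ^ 2 := by nlinarith
  have hx0 := hx.1
  have hδ : 0 ≤ 1 - r := by linarith
  have hl0 : 0 < l := by linarith
  have e4 : l ^ 3 * (1 - r) * x * 1 ≤
      l ^ 3 * (1 - r) * x * ((l ^ 2 * L ^ 2) * (1 + Real.log (1 / x))) :=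
    mul_le_mul_of_nonneg_left (by nlinarith) (by positivity)
  have e5 : 0 ≤ l ^ 3 * (1 - r) * x := by positivity
  linarith

end BoundedSolution

/-! ### Derivatives of solutions -/

theorem continuousWithinAt_periodicB1 (t : ℝ) : ContinuousWithinAt periodicB1 (Ici t) t := by
  have hev : periodicB1 =ᶠ[nhdsWithin t (Ici t)] fun u => u - ⌊t⌋ - 1 / 2 := by
    have := Filter.tendsto_pure.1 (tendsto_floor_right_pure_floor t)
    filter_upwards [this] with u hu
    simp only [periodicB1, Int.fract, hu]
  refine ContinuousWithinAt.congr_of_eventuallyEq (by fun_prop) hev ?_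
  rfl

namespace BoundedSolution

variable {lam : ℝ} {ψ : ℝ → ℝ}

theorem continuousWithinAt_one (h : BoundedSolution lam (|lam| / 2) ψ) (hlam : 2 ≤ |lam|) :
    ContinuousWithinAt ψ (Iic 1) 1 := by
  rw [ContinuousWithinAt, tendsto_iff_norm_sub_tendsto_zero]
  set N := 16 * |lam| ^ 3 * Real.log |lam| ^ 2
  have hlim : Filter.Tendsto (fun r : ℝ => N * (1 - r)) (nhdsWithin 1 (Iic 1)) (nhds 0) := by
    have : ContinuousWithinAt (fun r : ℝ => N * (1 - r)) (Iic 1) 1 := by fun_prop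
    simpa using this.tendsto
  refine squeeze_zero' (Filter.Eventually.of_forall fun r => norm_nonneg _) ?_ hlim
  have h12 : Ici (1 / 2 : ℝ) ∈ nhdsWithin (1 : ℝ) (Iic 1) :=
    mem_nhdsWithin_of_mem_nhds (Ici_mem_nhds (by norm_num))
  filter_upwards [self_mem_nhdsWithin, h12] with r hr1 hr
  have := h.abs_dilDiff_le_mul hlam hr hr1 (x := 1) (by simp)
  rwa [dilDiff, mul_one] at this

/-- Only left limits at `u = 1` enter here, and `B̃₁(1/(xu))` is continuous from the left in `u`;
so the formula holds also at the jumps of `x ↦ B̃₁(1/x)`. -/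
theorem tendsto_endTerm_div (h : BoundedSolution lam (|lam| / 2) ψ) (hlam : 2 ≤ |lam|) {x : ℝ}
    (hx : 0 < x) :
    Filter.Tendsto (fun r => endTerm ψ r x / (1 - r)) (nhdsWithin 1 (Iio 1))
      (nhds (recipB1 x * ψ 1)) := by
  have hβ : ContinuousWithinAt (fun u => recipB1 (x * u)) (Iic 1) 1 := by
    have h1 : ContinuousWithinAt (fun u : ℝ => (x * u)⁻¹) (Iic 1) 1 :=
      ContinuousAt.continuousWithinAt (ContinuousAt.inv₀ (by fun_prop) (by simpa using hx.ne'))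
    have h2 := continuousWithinAt_periodicB1 (x * 1)⁻¹
    have hmaps : (fun u : ℝ => (x * u)⁻¹) ⁻¹' Ici (x * 1)⁻¹ ∈ nhdsWithin (1 : ℝ) (Iic 1) := by
      filter_upwards [self_mem_nhdsWithin, mem_nhdsWithin_of_mem_nhds (Ioi_mem_nhds one_pos)]
        with u hu1 hu0
      exact inv_anti₀ (mul_pos hx hu0) (mul_le_mul_of_nonneg_left hu1 hx.le)
    exact h2.tendsto.comp
      (tendsto_nhdsWithin_of_tendsto_nhds_of_eventually_within _ h1 hmaps)
  have hf : ContinuousWithinAt (fun u => recipB1 (x * u) * ψ u) (Iic 1) 1 :=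
    hβ.mul (h.continuousWithinAt_one hlam)
  have hm : Measurable fun u => recipB1 (x * u) * ψ u :=
    (measurable_recipB1.comp (measurable_const_mul x)).mul h.measurable
  have hder := intervalIntegral.integral_hasDerivWithinAt_left (s := Iic 1)
    (h.intervalIntegrable x 1 1)
    (hm.stronglyMeasurable.stronglyMeasurableAtFilter) hf
  rw [hasDerivWithinAt_iff_tendsto_slope, Iic_sdiff_right] at hder
  have := hder.neg
  rw [neg_neg, mul_one] at this
  refine this.congr fun r => ?_
  rw [slope_def_field, intervalIntegral.integral_same, sub_zero, ← div_neg, neg_sub]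
  rfl

/-- The derivative estimate, from the left difference quotient at `x`, which is
`dilDiff ψ r x / ((r - 1) * x)` with `r → 1⁻`. -/
theorem abs_mul_deriv_add_le (h : BoundedSolution lam (|lam| / 2) ψ) (hlam : 2 ≤ |lam|)
    {x d : ℝ} (hx : x ∈ Ioc (0 : ℝ) 1) (hd : HasDerivWithinAt ψ d (Iic x) x) :
    |x * d - (-(lam * ψ 1 * periodicB1 (1 / x)))| ≤
      17 * (|lam| ^ 5 * Real.log |lam| ^ 2 * (1 + Real.log (1 / x)) * x) := by
  have hx0 : 0 < x := hx.1
  have hcomp : HasDerivWithinAt (fun r => ψ (r * x)) (d * x) (Iic 1) 1 := by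
    have h1 : HasDerivWithinAt (fun r : ℝ => r * x) x (Iic 1) 1 := by
      simpa using (hasDerivWithinAt_id (1 : ℝ) (Iic 1)).mul_const x
    have h2 : HasDerivWithinAt ψ d (Iic x) (1 * x) := by rwa [one_mul]
    exact h2.comp 1 h1 fun r hr => mul_le_of_le_one_left hx0.le hr
  rw [hasDerivWithinAt_iff_tendsto_slope, Iic_sdiff_right] at hcomp
  have hlim := (hcomp.neg.sub ((h.tendsto_endTerm_div hlam hx0).const_mul lam)).abs
  have hβ : recipB1 x = periodicB1 (1 / x) := by rw [recipB1, one_div]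
  have hbound := le_of_tendsto hlim
    (b := 17 * (|lam| ^ 5 * Real.log |lam| ^ 2 * (1 + Real.log (1 / x)) * x)) ?_
  · rw [hβ, ← abs_neg] at hbound
    refine (le_of_eq ?_).trans hbound
    congr 1
    ring
  · filter_upwards [self_mem_nhdsWithin,
      mem_nhdsWithin_of_mem_nhds (Ici_mem_nhds (by norm_num : (1 / 2 : ℝ) < 1))] with r hr1 hr
    have hδ : 0 < 1 - r := sub_pos.2 hr1
    have hmain := h.abs_dilDiff_sub_endTerm_le_mul hlam hr (le_of_lt hr1) hx
    rw [← div_le_iff₀ hδ] at hmain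
    refine (le_of_eq ?_).trans hmain
    have habs : |dilDiff ψ r x - lam * endTerm ψ r x| / (1 - r) =
        |(dilDiff ψ r x - lam * endTerm ψ r x) / (1 - r)| := by
      rw [abs_div, abs_of_pos hδ]
    rw [habs, slope_def_field, one_mul, ← div_neg, neg_sub, dilDiff, ← mul_div_assoc, ← sub_div]

theorem lipschitzOnWith (h : BoundedSolution lam (|lam| / 2) ψ) (hlam : 2 ≤ |lam|) {ε : ℝ}
    (hε : 0 < ε) : ∃ K, LipschitzOnWith K ψ (Icc ε 1) := by
  set N := 16 * |lam| ^ 3 * Real.log |lam| ^ 2 with hN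
  have hN0 : 0 ≤ N := by positivity
  set M := (N + 2 * |lam|) / ε with hM
  have hM0 : 0 ≤ M := by positivity
  have key : ∀ x ∈ Icc ε 1, ∀ y ∈ Icc ε 1, y ≤ x → |ψ y - ψ x| ≤ M * (x - y) := by
    intro x hx y hy hyx
    have hx0 : 0 < x := hε.trans_le hx.1
    have hle : (N + 2 * |lam|) * ((x - y) / x) ≤ M * (x - y) := by
      rw [hM, div_mul_eq_mul_div, ← mul_div_assoc]
      exact div_le_div_of_nonneg_left
        (mul_nonneg (by positivity) (by linarith)) hε hx.1
    refine le_trans ?_ hle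
    have h1 : (x - y) / x = 1 - y / x := by field_simp
    have hyx1 : y / x ≤ 1 := (div_le_one hx0).2 hyx
    rw [h1]
    rcases le_or_gt (1 / 2) (y / x) with hr | hr
    · have := h.abs_dilDiff_le_mul hlam hr hyx1 ⟨hx0, hx.2⟩
      rw [dilDiff, div_mul_cancel₀ _ hx0.ne'] at this
      nlinarith [abs_nonneg lam]
    · have h2 := h.bound x
      have h3 := h.bound y
      have h4 := abs_sub (ψ y) (ψ x)
      nlinarith [abs_nonneg lam]
  refine ⟨⟨M, hM0⟩, LipschitzOnWith.of_dist_le_mul fun x hx y hy => ?_⟩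
  rw [Real.dist_eq, Real.dist_eq]
  rcases le_total y x with hyx | hyx
  · rw [abs_sub_comm, abs_of_nonneg (sub_nonneg.2 hyx)]
    exact key x hx y hy hyx
  · rw [abs_sub_comm x y, abs_of_nonneg (sub_nonneg.2 hyx)]
    exact key y hy x hx hyx

theorem ae_differentiableAt (h : BoundedSolution lam (|lam| / 2) ψ) (hlam : 2 ≤ |lam|) :
    ∀ᵐ x, x ∈ Ioo (0 : ℝ) 1 → DifferentiableAt ℝ ψ x := by
  have hn : ∀ n : ℕ, ∀ᵐ x, x ∈ Icc (1 / ((n : ℝ) + 1)) 1 →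
      DifferentiableWithinAt ℝ ψ (Icc (1 / ((n : ℝ) + 1)) 1) x := fun n => by
    obtain ⟨K, hK⟩ := h.lipschitzOnWith hlam (ε := 1 / ((n : ℝ) + 1)) (by positivity)
    exact hK.ae_differentiableWithinAt_of_mem_real
  filter_upwards [ae_all_iff.2 hn] with x hx hx01
  obtain ⟨n, hn⟩ := exists_nat_one_div_lt hx01.1
  exact (hx n ⟨hn.le, hx01.2.le⟩).differentiableAt (Icc_mem_nhds hn hx01.2)

end BoundedSolution

/-- Both numbers are small only if `t` is near `1/2` modulo `1`, and then `2 * t` is near `0`. -/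
theorem quarter_le_abs_periodicB1_add (t : ℝ) :
    1 / 4 ≤ |periodicB1 t| + |periodicB1 (2 * t)| := by
  have h0 := Int.fract_nonneg t
  have h1 := Int.fract_lt_one t
  have hfl := Int.floor_add_fract t
  have a1 := neg_abs_le (periodicB1 t)
  have a2 := le_abs_self (periodicB1 t)
  have a3 := neg_abs_le (periodicB1 (2 * t))
  have a4 := le_abs_self (periodicB1 (2 * t))
  rcases lt_or_ge (Int.fract t) (1 / 2) with hlt | hge
  · have h2 : Int.fract (2 * t) = 2 * Int.fract t :=
      Int.fract_eq_iff.2 ⟨by linarith, by linarith, 2 * ⌊t⌋, by push_cast; linarith⟩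
    simp only [periodicB1, h2] at *
    linarith
  · have h2 : Int.fract (2 * t) = 2 * Int.fract t - 1 :=
      Int.fract_eq_iff.2 ⟨by linarith, by linarith, 2 * ⌊t⌋ + 1, by push_cast; linarith⟩
    simp only [periodicB1, h2] at *
    linarith

/-- Integrability near `0` is invariant under `x ↦ x / 2`, and `quarter_le_abs_periodicB1_add`
would make `1/x` integrable. -/
theorem not_intervalIntegrable_inv_mul_recipB1 :
    ¬ IntervalIntegrable (fun x => x⁻¹ * recipB1 x) volume 0 1 := by
  intro hI
  have hI2 : IntervalIntegrable (fun x => (1 / 2 * x)⁻¹ * recipB1 (1 / 2 * x)) volume 0 1 := by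
    have := hI.comp_mul_left (c := 1 / 2)
    refine this.mono_set ?_
    norm_num
    exact Icc_subset_Icc_right one_le_two
  have hsum := (hI.norm.const_mul 4).add (hI2.norm.const_mul 2)
  have hinv : IntervalIntegrable (fun x : ℝ => x⁻¹) volume 0 1 := by
    refine hsum.mono_fun measurable_inv.aestronglyMeasurable
      ((ae_restrict_mem measurableSet_uIoc).mono fun x hx => ?_)
    rw [uIoc_of_le zero_le_one] at hx
    have hx0 : 0 < x⁻¹ := inv_pos.2 hx.1
    have hq := quarter_le_abs_periodicB1_add x⁻¹
    have h2 : recipB1 (1 / 2 * x) = periodicB1 (2 * x⁻¹) := by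
      rw [recipB1, mul_inv, one_div, inv_inv]
    refine le_trans ?_ (le_abs_self _)
    rw [h2, show (1 / 2 * x)⁻¹ = 2 * x⁻¹ by rw [mul_inv, one_div, inv_inv], recipB1]
    simp only [norm_mul, Real.norm_eq_abs, abs_of_pos hx0, abs_two]
    nlinarith
  rw [intervalIntegrable_inv_iff] at hinv
  rcases hinv with h | h
  · norm_num at h
  · exact h left_mem_uIcc

namespace BoundedSolution

variable {lam : ℝ} {ψ : ℝ → ℝ}

theorem integrableOn_deriv_iff (h : BoundedSolution lam (|lam| / 2) ψ) (hlam : 2 ≤ |lam|) :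
    IntegrableOn (deriv ψ) (Ioo 0 1) volume ↔ ψ 1 = 0 := by
  have hlam0 : lam ≠ 0 := by
    rintro rfl
    norm_num at hlam
  set c := lam * ψ 1 with hc
  set C := 17 * (|lam| ^ 5 * Real.log |lam| ^ 2) with hC
  have hmain : IntegrableOn (fun x => deriv ψ x + c * (x⁻¹ * recipB1 x)) (Ioo 0 1) volume := by
    have hlogI : IntegrableOn (fun x : ℝ => C * (1 - Real.log x)) (Ioo 0 1) volume := by
      have h1 : IntervalIntegrable (fun x : ℝ => C * (1 - Real.log x)) volume 0 1 :=
        (intervalIntegrable_const.sub intervalIntegral.intervalIntegrable_log').const_mul C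
      exact ((intervalIntegrable_iff_integrableOn_Ioc_of_le zero_le_one).1 h1).mono_set
        Ioo_subset_Ioc_self
    have hmeas : Measurable fun x => deriv ψ x + c * (x⁻¹ * recipB1 x) :=
      (measurable_deriv ψ).add ((measurable_inv.mul measurable_recipB1).const_mul c)
    refine Integrable.mono' hlogI hmeas.aestronglyMeasurable ?_
    rw [ae_restrict_iff' measurableSet_Ioo]
    filter_upwards [h.ae_differentiableAt hlam] with x hx hx01
    have hb := h.abs_mul_deriv_add_le hlam ⟨hx01.1, hx01.2.le⟩
      (hx hx01).hasDerivAt.hasDerivWithinAt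
    have hx0 := hx01.1
    have hβ : recipB1 x = periodicB1 (1 / x) := by rw [recipB1, one_div]
    have e1 : deriv ψ x + c * (x⁻¹ * recipB1 x) =
        (x * deriv ψ x - (-(lam * ψ 1 * periodicB1 (1 / x)))) / x := by
      rw [hβ]
      field_simp
      ring
    rw [Real.norm_eq_abs, e1, abs_div, abs_of_pos hx0, div_le_iff₀ hx0]
    refine hb.trans (le_of_eq ?_)
    rw [one_div, Real.log_inv]
    ring
  have hiff : IntegrableOn (fun x => x⁻¹ * recipB1 x) (Ioo 0 1) volume ↔
      IntervalIntegrable (fun x => x⁻¹ * recipB1 x) volume 0 1 := by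
    rw [intervalIntegrable_iff_integrableOn_Ioc_of_le zero_le_one,
      integrableOn_Ioc_iff_integrableOn_Ioo]
  constructor
  · intro hI
    by_contra hne
    have hc0 : c ≠ 0 := mul_ne_zero hlam0 hne
    refine not_intervalIntegrable_inv_mul_recipB1 (hiff.1 ?_)
    have h1 := (hmain.sub hI).const_mul c⁻¹
    refine h1.congr (Filter.Eventually.of_forall fun x => ?_)
    simp [hc0]
  · intro h0
    have : c = 0 := by rw [hc, h0, mul_zero]
    simpa [this] using hmain

end BoundedSolution

/-! ### Eigenfunctions -/

theorem kernelK_eq_neg_recipB1 {x y : ℝ} (hx : x ≠ 0) (hy : y ≠ 0) :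
    kernelK x y = -recipB1 (x * y) := by
  rw [kernelK, if_neg (mul_ne_zero hx hy), recipB1, periodicB1, neg_sub]

theorem abs_mul_le_of_abs_le {a b C : ℝ} (h : |a| ≤ C) : ‖a * b‖ ≤ C * |b| := by
  rw [norm_mul]
  exact mul_le_mul_of_nonneg_right h (abs_nonneg _)

/-- A normalised eigenfunction agrees on `(0, 1]` with a bounded Borel solution, given by the right
side of the integral equation. The bound is `|φ| ≤ |lam| / 2 * ∫ |φ|`, and comparing it
with `∫ φ² = 1` gives `2 ≤ |lam|`. -/
theorem IsEigenfunctionK.exists_boundedSolution {lam : ℝ} {φ : ℝ → ℝ} (h : IsEigenfunctionK lam φ)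
    (hnorm : unitL2Norm φ = 1) :
    2 ≤ |lam| ∧ ∃ ψ, BoundedSolution lam (|lam| / 2) ψ ∧ EqOn φ ψ (Ioc 0 1) := by
  have hmem : MemLp φ 2 (volume.restrict (Ioc (0 : ℝ) 1)) :=
    h.memLp.mono_measure (Measure.restrict_mono Ioc_subset_Icc_self le_rfl)
  have hsqI : IntegrableOn (fun x => φ x ^ 2) (Ioc 0 1) volume := hmem.integrable_sq
  have hI : IntegrableOn (fun x => |φ x|) (Ioc 0 1) volume :=
    (hmem.integrable one_le_two).abs
  have hsq : ∫ x in Ioc (0 : ℝ) 1, φ x ^ 2 = 1 := by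
    rw [unitL2Norm, Real.sqrt_eq_one, integral_Icc_eq_integral_Ioc] at hnorm
    exact hnorm
  have hL1 : ∫ x in Ioc (0 : ℝ) 1, |φ x| ≤ 1 := by
    have hle : ∫ x in Ioc (0 : ℝ) 1, |φ x| ≤ ∫ x in Ioc (0 : ℝ) 1, (1 / 2 + 1 / 2 * φ x ^ 2) := by
      refine integral_mono hI ((integrable_const _).add (hsqI.const_mul _)) fun x => ?_
      have := sq_nonneg (|φ x| - 1)
      simp only
      rw [← sq_abs (φ x)]
      linarith
    rw [integral_add (integrable_const _) (hsqI.const_mul _), integral_const_mul, hsq] at hle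
    simp at hle
    linarith
  set ψ : ℝ → ℝ := fun x => -lam * opT φ x with hψ
  have hφψ : EqOn φ ψ (Ioc 0 1) := by
    intro x hx
    have hK : ∫ y in Ioc (0 : ℝ) 1, kernelK x y * φ y =
        -∫ y in Ioc (0 : ℝ) 1, recipB1 (x * y) * φ y := by
      rw [← integral_neg]
      refine setIntegral_congr_fun measurableSet_Ioc fun y hy => ?_
      rw [kernelK_eq_neg_recipB1 hx.1.ne' hy.1.ne', neg_mul]
    rw [h.eq_integral x ⟨hx.1.le, hx.2⟩, integral_Icc_eq_integral_Ioc, hK, hψ]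
    simp only [opT]
    rw [intervalIntegral.integral_of_le zero_le_one]
    ring
  have hmeas : Measurable ψ := by
    have hae := hmem.aestronglyMeasurable
    have : opT φ = opT (hae.mk φ) := by
      funext x
      unfold opT
      rw [intervalIntegral.integral_of_le zero_le_one, intervalIntegral.integral_of_le zero_le_one]
      refine integral_congr_ae (hae.ae_eq_mk.mono fun y hy => ?_)
      simp only
      rw [← hy]
    rw [hψ, this]
    exact (measurable_opT hae.stronglyMeasurable_mk.measurable).const_mul _
  have hbound : ∀ x, |ψ x| ≤ |lam| / 2 := by
    intro x
    have h1 : |opT φ x| ≤ ∫ y in Ioc (0 : ℝ) 1, 1 / 2 * |φ y| := by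
      unfold opT
      rw [intervalIntegral.integral_of_le zero_le_one]
      exact norm_integral_le_of_norm_le (hI.const_mul _)
        (Filter.Eventually.of_forall fun y => abs_mul_le_of_abs_le (abs_recipB1_le _))
    rw [integral_const_mul] at h1
    rw [hψ]
    simp only
    rw [abs_mul, abs_neg, div_eq_mul_one_div]
    exact mul_le_mul_of_nonneg_left (by linarith) (abs_nonneg _)
  have hlam : 2 ≤ |lam| := by
    have hle : ∫ x in Ioc (0 : ℝ) 1, φ x ^ 2 ≤ ∫ x in Ioc (0 : ℝ) 1, |lam| / 2 * |φ x| := by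
      refine setIntegral_mono_on hsqI (hI.const_mul _) measurableSet_Ioc fun x hx => ?_
      rw [← sq_abs, sq]
      refine mul_le_mul_of_nonneg_right ?_ (abs_nonneg _)
      rw [hφψ hx]
      exact hbound x
    rw [integral_const_mul, hsq] at hle
    nlinarith [abs_nonneg lam]
  refine ⟨hlam, ψ, ⟨hmeas, hbound, fun x => ?_⟩, hφψ⟩
  have : opT ψ x = opT φ x := by
    unfold opT
    rw [intervalIntegral.integral_of_le zero_le_one, intervalIntegral.integral_of_le zero_le_one]
    refine setIntegral_congr_fun measurableSet_Ioc fun y hy => ?_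
    rw [hφψ hy]
  rw [this]

theorem theorem5p4 :
    ∃ C : ℝ, ∀ (lam : ℝ) (φ : ℝ → ℝ), IsEigenfunctionK lam φ → unitL2Norm φ = 1 →
      (∀ x ∈ Ioc (0 : ℝ) 1, ∀ d : ℝ, HasDerivWithinAt φ d (Icc 0 1) x →
        |x * d - (-(lam * φ 1 * periodicB1 (1 / x)))| ≤
          C * (|lam| ^ 5 * Real.log |lam| ^ 2 * (1 + Real.log (1 / x)) * x)) ∧
      (∀ᵐ x ∂(volume.restrict (Icc (0 : ℝ) 1)), DifferentiableWithinAt ℝ φ (Icc 0 1) x) ∧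
      (IntegrableOn (derivWithin φ (Icc 0 1)) (Icc 0 1) volume ↔ φ 1 = 0) := by
  refine ⟨17, fun lam φ h hnorm => ?_⟩
  obtain ⟨hlam, ψ, hψ, heq⟩ := h.exists_boundedSolution hnorm
  have h1 : φ 1 = ψ 1 := heq (by simp)
  have hnhds : ∀ x ∈ Ioo (0 : ℝ) 1, φ =ᶠ[nhds x] ψ := fun x hx =>
    (heq.mono Ioo_subset_Ioc_self).eventuallyEq_of_mem (isOpen_Ioo.mem_nhds hx)
  refine ⟨fun x hx d hd => ?_, ?_, ?_⟩
  · rw [h1]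
    refine hψ.abs_mul_deriv_add_le hlam hx ?_
    -- Pass to the left neighbourhood `(0, x]`, on which `φ` and `ψ` agree.
    have h2 : HasDerivWithinAt ψ d (Ioc 0 x) x :=
      (hd.mono fun y hy => ⟨hy.1.le, hy.2.trans hx.2⟩).congr
        (fun y hy => (heq ⟨hy.1, hy.2.trans hx.2⟩).symm) (heq hx).symm
    exact h2.mono_of_mem_nhdsWithin (Ioc_mem_nhdsLE hx.1)
  · rw [restrict_Ioo_eq_restrict_Icc.symm, ae_restrict_iff' measurableSet_Ioo]
    filter_upwards [hψ.ae_differentiableAt hlam] with x hx hx01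
    exact ((hnhds x hx01).differentiableAt_iff.2 (hx hx01)).differentiableWithinAt
  · rw [h1, ← hψ.integrableOn_deriv_iff hlam, integrableOn_Icc_iff_integrableOn_Ioo]
    refine integrableOn_congr_fun (fun x hx => ?_) measurableSet_Ioo
    rw [derivWithin_of_mem_nhds (Icc_mem_nhds hx.1 hx.2), (hnhds x hx).deriv_eq]
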